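/- Let $M$ be a smooth $n$-dimensional manifold and $f:M\to\mathbb R^m$ a smooth immersion, so that $M$ is an (immersed) submanifold of Euclidean space; let $g$ be the induced metric on $M$, $R$ its Riemann curvature tensor viewed as a $(2,2)$-double form (with the sign for which $R(u,v,u,v)$ is the sectional curvature of orthonormal $u,v$), and $B$ its vector-valued second fundamental form, with $B_N(u,v)=\langle B(u,v),N\rangle$ for a normal vector $N$. Double forms are multiplied by the exterior product $(\theta_1\otimes\theta_2)(\theta_3\otimes\theta_4)=(\theta_1\wedge\theta_3)\otimes(\theta_2\wedge\theta_4)$; the Hodge star and the inner product are extended to them by $*(\theta_1\otimes\theta_2)=*\theta_1\otimes *\theta_2$ and $\langle\theta_1\otimes\theta_2,\theta_3\otimes\theta_4\rangle=\langle\theta_1,\theta_3\rangle\langle\theta_2,\theta_4\rangle$; and $c$ denotes the Ricci contraction. Let $k\ge 0$ be an integer with $2k<n$. For a normal vector $N$ put $$h_{2k+1}(N)=*\Big(\tfrac{1}{(n-2k-1)!}\,g^{\,n-2k-1}R^kB_N\Big),$$ and call $M$ $(2k)$-minimal if $h_{2k+1}(N)=0$ for every normal vector $N$ at every point of $M$.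 Put $$h_{2k}=*\Big(\tfrac{1}{(n-2k)!}\,g^{\,n-2k}R^k\Big),\qquad T_0=g,\qquad T_{2k}=h_{2k}\,g-\tfrac{1}{(2k-1)!}\,c^{2k-1}R^k\quad(k\ge 1),$$ and, for a smooth function $u$ on $M$, $\ell_{2k}(u)=-\langle T_{2k},\mathrm{Hess}(u)\rangle$, where $\mathrm{Hess}$ is the Hessian for $g$. **Theorem.** $M$ is $(2k)$-minimal if and only if each of the restricted coordinate functions $x_i\circ f$ $(1\le i\le m)$ satisfies $\ell_{2k}(x_i\circ f)=0$ on $M$. -/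

import Mathlib

open scoped Manifold ContDiff TensorProduct RealInnerProductSpace

noncomputable section

namespace GaussBonnet

/-! ### Exterior forms and double forms on an `n`-dimensional space with an inner product

All tensors at a point are written in the standard basis of `ℝⁿ` (for a manifold: the coordinate
basis of a chart). The inner product is given by its Gram matrix `G`. -/

/-- The `n`-dimensional coordinate space. -/
abbrev Vec (n : ℕ) : Type := EuclideanSpace ℝ (Fin n)

/-- The `i`-th vector of the standard basis. -/
def basisVec {n : ℕ} (i : Fin n) : Vec n := EuclideanSpace.single i 1

/-- The dual space of `Vec n`. -/
abbrev Covec (n : ℕ) : Type := Module.Dual ℝ (Vec n)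

/-- The `i`-th covector of the dual standard basis. -/
def basisCovec {n : ℕ} (i : Fin n) : Covec n := (EuclideanSpace.proj i : Vec n →L[ℝ] ℝ).toLinearMap

/-- The exterior algebra `Λ(V*)` of forms on `V = Vec n`. -/
abbrev Forms (n : ℕ) : Type := ExteriorAlgebra ℝ (Covec n)

/-- The algebra `Λ(V*) ⊗ Λ(V*)` of double forms. Its multiplication is the exterior product of
double forms, `(θ₁ ⊗ θ₂) * (θ₃ ⊗ θ₄) = (θ₁ ∧ θ₃) ⊗ (θ₂ ∧ θ₄)`. -/
abbrev DoubleForms (n : ℕ) : Type := Forms n ⊗[ℝ] Forms n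

/-- The covector `eⁱ` seen as a `1`-form. -/
def basisForm {n : ℕ} (i : Fin n) : Forms n := ExteriorAlgebra.ι ℝ (basisCovec i)

/-- Interior product of a vector with a form (contraction of the first argument). -/
def vecInterior {n : ℕ} : Vec n →ₗ[ℝ] Module.End ℝ (Forms n) :=
  (CliffordAlgebra.contractLeft (Q := (0 : QuadraticForm ℝ (Covec n)))).comp
    (Module.Dual.eval ℝ (Vec n))

lemma vecInterior_mul_self {n : ℕ} (v : Vec n) : vecInterior v * vecInterior v = 0 := by
  exact LinearMap.ext fun x => CliffordAlgebra.contractLeft_contractLeft _ x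

/-- The vector `α♯` dual to the covector `α` for the inner product with Gram matrix `G`. -/
def sharp {n : ℕ} (G : Matrix (Fin n) (Fin n) ℝ) : Covec n →ₗ[ℝ] Vec n :=
  ∑ i, ∑ j, (G⁻¹ i j) • (LinearMap.applyₗ (basisVec j)).smulRight (basisVec i)

/-- Interior product of a form with a form: `α₁ ∧ ⋯ ∧ α_p` acts as
`ι(α_p♯) ∘ ⋯ ∘ ι(α₁♯)`. -/
def formInterior {n : ℕ} (G : Matrix (Fin n) (Fin n) ℝ) :
    Forms n →ₗ[ℝ] Module.End ℝ (Forms n) :=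
  (MulOpposite.opLinearEquiv ℝ).symm.toLinearMap.comp
    (ExteriorAlgebra.lift ℝ
      ⟨(MulOpposite.opLinearEquiv ℝ).toLinearMap.comp (vecInterior.comp (sharp G)), fun α => by
        change MulOpposite.op (vecInterior (sharp G α)) * MulOpposite.op (vecInterior (sharp G α)) = 0
        rw [← MulOpposite.op_mul, vecInterior_mul_self, MulOpposite.op_zero]⟩).toLinearMap

/-- The volume form `√(det G) e¹ ∧ ⋯ ∧ eⁿ`. -/
def volForm {n : ℕ} (G : Matrix (Fin n) (Fin n) ℝ) : Forms n :=
  Real.sqrt G.det • ExteriorAlgebra.ιMulti ℝ n (fun i : Fin n => basisCovec i)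

/-- The Hodge star operator, `*(e¹ ∧ ⋯ ∧ e^p) = e^{p+1} ∧ ⋯ ∧ eⁿ` on positively oriented
orthonormal covectors. -/
def hodgeStar {n : ℕ} (G : Matrix (Fin n) (Fin n) ℝ) : Forms n →ₗ[ℝ] Forms n :=
  (formInterior G).flip (volForm G)

/-- The inner product of forms, `⟨α₁ ∧ ⋯ ∧ α_p, β₁ ∧ ⋯ ∧ β_p⟩ = det ⟨α_i, β_j⟩`; forms of
different degrees are orthogonal. -/
def formInner {n : ℕ} (G : Matrix (Fin n) (Fin n) ℝ) : LinearMap.BilinForm ℝ (Forms n) :=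
  (formInterior G).compr₂ ExteriorAlgebra.algebraMapInv.toLinearMap

/-- The Hodge star operator of double forms, `*(θ₁ ⊗ θ₂) = *θ₁ ⊗ *θ₂` (it does not depend on the
choice of an orientation). -/
def doubleStar {n : ℕ} (G : Matrix (Fin n) (Fin n) ℝ) : DoubleForms n →ₗ[ℝ] DoubleForms n :=
  TensorProduct.map (hodgeStar G) (hodgeStar G)

/-- The inner product of double forms,
`⟨θ₁ ⊗ θ₂, θ₃ ⊗ θ₄⟩ = ⟨θ₁, θ₃⟩ ⟨θ₂, θ₄⟩`. -/
def doubleInner {n : ℕ} (G : Matrix (Fin n) (Fin n) ℝ) : LinearMap.BilinForm ℝ (DoubleForms n) :=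
  LinearMap.BilinForm.tmul (formInner G) (formInner G)

/-- The Ricci contraction
`(c ω)(x₁, …, y₁, …) = ∑ⱼ ω(eⱼ, x₁, …, eⱼ, y₁, …)` for an orthonormal basis `(eⱼ)`; it is
written in the standard basis by means of the inverse of the Gram matrix. -/
def contraction {n : ℕ} (G : Matrix (Fin n) (Fin n) ℝ) : Module.End ℝ (DoubleForms n) :=
  ∑ i, ∑ j, (G⁻¹ i j) • TensorProduct.map (vecInterior (basisVec i)) (vecInterior (basisVec j))

/-- The scalar that corresponds to a `(0, 0)`-double form. -/
def scalarPart {n : ℕ} : DoubleForms n →ₐ[ℝ] ℝ :=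
  (Algebra.TensorProduct.lmul' ℝ).comp
    (Algebra.TensorProduct.map ExteriorAlgebra.algebraMapInv ExteriorAlgebra.algebraMapInv)

/-- The `(1, 1)`-double form with components `b i j`. -/
def doubleForm11 {n : ℕ} (b : Fin n → Fin n → ℝ) : DoubleForms n :=
  ∑ i, ∑ j, b i j • (basisForm i ⊗ₜ[ℝ] basisForm j)

/-- The `(2, 2)`-double form with components `r i j k l` (for `r` skew in `i, j` and in `k, l`). -/
def doubleForm22 {n : ℕ} (r : Fin n → Fin n → Fin n → Fin n → ℝ) : DoubleForms n :=
  (1 / 4 : ℝ) • ∑ i, ∑ j, ∑ k, ∑ l,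
    r i j k l • ((basisForm i * basisForm j) ⊗ₜ[ℝ] (basisForm k * basisForm l))

/-! ### Riemannian geometry in charts -/

/-- The partial derivative `∂ᵢF` at `y`. -/
def partialDeriv {n : ℕ} {W : Type*} [NormedAddCommGroup W] [NormedSpace ℝ W]
    (i : Fin n) (F : Vec n → W) (y : Vec n) : W :=
  fderiv ℝ F y (basisVec i)

/-- The Christoffel symbols `Γˡᵢⱼ` (written `christoffel G l i j`) of a metric `G` on (an open
subset of) the coordinate space. -/
def christoffel {n : ℕ} (G : Vec n → Matrix (Fin n) (Fin n) ℝ) (l i j : Fin n) (y : Vec n) : ℝ :=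
  (1 / 2 : ℝ) * ∑ s, (G y)⁻¹ l s *
    (partialDeriv i (fun z => G z j s) y + partialDeriv j (fun z => G z i s) y
      - partialDeriv s (fun z => G z i j) y)

/-- The components of the curvature operator:
`(∇ᵢ∇ⱼ - ∇ⱼ∇ᵢ) ∂ₖ = ∑ₗ (curvatureOp G l i j k) ∂ₗ`. -/
def curvatureOp {n : ℕ} (G : Vec n → Matrix (Fin n) (Fin n) ℝ) (l i j k : Fin n) (y : Vec n) : ℝ :=
  partialDeriv i (christoffel G l j k) y - partialDeriv j (christoffel G l i k) y
    + ∑ s, (christoffel G s j k y * christoffel G l i s y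
      - christoffel G s i k y * christoffel G l j s y)

/-- The Riemann curvature tensor `R(∂ᵢ, ∂ⱼ, ∂ₖ, ∂ₗ) = g((∇ᵢ∇ⱼ - ∇ⱼ∇ᵢ) ∂ₗ, ∂ₖ)`, with the sign for
which `R(u, v, u, v)` is the sectional curvature of orthonormal `u, v`. -/
def riemann {n : ℕ} (G : Vec n → Matrix (Fin n) (Fin n) ℝ) (i j k l : Fin n) (y : Vec n) : ℝ :=
  ∑ s, G y k s * curvatureOp G s i j l y

section Manifold

variable {n : ℕ} {M : Type*} [TopologicalSpace M] [ChartedSpace (Vec n) M]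

/-- A field of bilinear forms on the tangent spaces of `M`. The notions below are the standard ones
for fields that are smooth Riemannian metrics, such as the metric induced by an immersion. -/
abbrev MetricField (n : ℕ) (M : Type*) [TopologicalSpace M] [ChartedSpace (Vec n) M] : Type _ :=
  (x : M) → LinearMap.BilinForm ℝ (TangentSpace (𝓡 n) x)

/-- The Gram matrix of the coordinate vector fields, in the preferred chart at `x`, as a function
on the coordinate space. -/
def gram (g : MetricField n M) (x : M) (y : Vec n) : Matrix (Fin n) (Fin n) ℝ :=
  Matrix.of fun i j =>
    g ((extChartAt (𝓡 n) x).symm y)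
      (mfderiv 𝓘(ℝ, Vec n) (𝓡 n) (extChartAt (𝓡 n) x).symm y (basisVec i))
      (mfderiv 𝓘(ℝ, Vec n) (𝓡 n) (extChartAt (𝓡 n) x).symm y (basisVec j))

/-- The Gram matrix at the point `x`. -/
def gramAt (g : MetricField n M) (x : M) : Matrix (Fin n) (Fin n) ℝ :=
  gram g x (extChartAt (𝓡 n) x x)

/-- The metric at `x` as a `(1, 1)`-double form. -/
def metricForm (g : MetricField n M) (x : M) : DoubleForms n :=
  doubleForm11 (gramAt g x)

/-- The Riemann curvature tensor at `x` as a `(2, 2)`-double form. -/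
def curvatureForm (g : MetricField n M) (x : M) : DoubleForms n :=
  doubleForm22 fun i j k l => riemann (gram g x) i j k l (extChartAt (𝓡 n) x x)

/-- The `2k`-th Gauss-Bonnet curvature `h_{2k} = *(g^{n-2k} R^k / (n-2k)!)`, for `2k ≤ n`. -/
def gaussBonnetCurvature (g : MetricField n M) (k : ℕ) (x : M) : ℝ :=
  scalarPart (doubleStar (gramAt g x)
    ((1 / (Nat.factorial (n - 2 * k) : ℝ)) •
      (metricForm g x ^ (n - 2 * k) * curvatureForm g x ^ k)))

/-- The Einstein-Lovelock tensor of order `2k`, as a `(1, 1)`-double form: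
`T₀ = g` and `T_{2k} = h_{2k} g - c^{2k-1} R^k / (2k-1)!` for `k ≥ 1`. -/
def einsteinLovelock (g : MetricField n M) (k : ℕ) (x : M) : DoubleForms n :=
  if k = 0 then metricForm g x
  else gaussBonnetCurvature g k x • metricForm g x
    - (1 / (Nat.factorial (2 * k - 1) : ℝ)) •
      (contraction (gramAt g x) ^ (2 * k - 1)) (curvatureForm g x ^ k)

/-- The Hessian `∇df` of a function at `x`, as a `(1, 1)`-double form, with components
`∂ᵢ∂ⱼf - ∑ₗ Γˡᵢⱼ ∂ₗf`. -/
def hessianForm (g : MetricField n M) (f : M → ℝ) (x : M) : DoubleForms n :=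
  doubleForm11 fun i j =>
    let F : Vec n → ℝ := f ∘ (extChartAt (𝓡 n) x).symm
    let y : Vec n := extChartAt (𝓡 n) x x
    partialDeriv i (partialDeriv j F) y
      - ∑ l, christoffel (gram g x) l i j y * partialDeriv l F y

/-- The operator `ℓ_{2k}(f) = -⟨T_{2k}, Hess f⟩`. -/
def ell (g : MetricField n M) (k : ℕ) (f : M → ℝ) (x : M) : ℝ :=
  - doubleInner (gramAt g x) (einsteinLovelock g k x) (hessianForm g f x)

/-- `f` is `ℓ_{2k}`-harmonic: `ℓ_{2k}(f) = 0` on `M`. -/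
def IsEllHarmonic (g : MetricField n M) (k : ℕ) (f : M → ℝ) : Prop :=
  ∀ x, ell g k f x = 0

/-! ### Immersed submanifolds of Euclidean space -/

variable {m : ℕ}

/-- The differential of `f : M → ℝᵐ` at `x`. -/
def differential (f : M → Vec m) (x : M) : TangentSpace (𝓡 n) x →L[ℝ] Vec m :=
  mfderiv (𝓡 n) 𝓘(ℝ, Vec m) f x

/-- `f` is a smooth immersion of `M` into `ℝᵐ`. -/
def IsSmoothImmersion (f : M → Vec m) : Prop :=
  ContMDiff (𝓡 n) 𝓘(ℝ, Vec m) ∞ f ∧ ∀ x, Function.Injective (differential (n := n) f x)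

/-- The metric induced on `M` by `f : M → ℝᵐ` (first fundamental form),
`g(u, v) = ⟨df(u), df(v)⟩`. -/
def inducedMetric (f : M → Vec m) : MetricField n M :=
  fun x => (innerₗ (Vec m)).compl₁₂ (differential f x).toLinearMap (differential f x).toLinearMap

/-- The normal space of the immersed submanifold at `x`. -/
def normalSpace (n : ℕ) [ChartedSpace (Vec n) M] (f : M → Vec m) (x : M) : Submodule ℝ (Vec m) :=
  (LinearMap.range (differential (n := n) f x).toLinearMap)ᗮ

/-- The vector valued second fundamental form `B(∂ᵢ, ∂ⱼ)` at `x`: the normal component of the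
derivative of the tangent field `∂ⱼ` in the direction `∂ᵢ`. -/
def secondFundamentalForm (n : ℕ) [ChartedSpace (Vec n) M] (f : M → Vec m) (x : M)
    (i j : Fin n) : Vec m :=
  (normalSpace n f x).starProjection
    (partialDeriv i (partialDeriv j (f ∘ (extChartAt (𝓡 n) x).symm)) (extChartAt (𝓡 n) x x))

/-- `B_N(u, v) = ⟨B(u, v), N⟩` at `x`, as a `(1, 1)`-double form. -/
def secondFundamentalFormAlong (n : ℕ) [ChartedSpace (Vec n) M] (f : M → Vec m) (x : M)
    (N : Vec m) : DoubleForms n :=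
  doubleForm11 fun i j => ⟪secondFundamentalForm n f x i j, N⟫

/-- The `(2k+1)`-th Gauss-Bonnet curvature of the submanifold at `x` in the normal direction `N`,
`h_{2k+1}(N) = *(g^{n-2k-1} R^k B_N / (n-2k-1)!)`, for `2k + 1 ≤ n`. -/
def oddGaussBonnetCurvature (n : ℕ) [ChartedSpace (Vec n) M] (f : M → Vec m) (k : ℕ) (x : M)
    (N : Vec m) : ℝ :=
  scalarPart (doubleStar (gramAt (inducedMetric (n := n) f) x)
    ((1 / (Nat.factorial (n - 2 * k - 1) : ℝ)) •
      (metricForm (inducedMetric (n := n) f) x ^ (n - 2 * k - 1)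
        * curvatureForm (inducedMetric (n := n) f) x ^ k
        * secondFundamentalFormAlong n f x N)))

/-- The submanifold is `(2k)`-minimal: `h_{2k+1}(N) = 0` for all normal vectors `N`. -/
def IsTwoKMinimal (n : ℕ) [ChartedSpace (Vec n) M] (f : M → Vec m) (k : ℕ) : Prop :=
  ∀ x : M, ∀ N ∈ normalSpace n f x, oddGaussBonnetCurvature n f k x N = 0

end Manifold

end GaussBonnet

end

/-! The theorem rests on two facts. Algebraic: `h_{2k+1}(N) = ⟨T_{2k}, B_N⟩` at each point.
Geometric (Gauss formula): the Hessian of the `a`-th coordinate function is the `a`-th component of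
`B`. Together they give `ℓ_{2k}(x_a) = -⟨T_{2k}, ⟨B, e_a⟩⟩`. Since `B` is normal, this equals
`-h_{2k+1}` at the normal part of `e_a`; since `B_N` is linear in `N`, conversely `h_{2k+1}(N) = -∑
N_a ℓ_{2k}(x_a)`. Both implications are then immediate (`ell_coord`,
`oddGaussBonnetCurvature_eq_sum`).

For the algebraic fact, the Hodge star on top degree double forms is `c^n / n!`
(`scalarPart_doubleStar`). The iterated commutators of `c` with multiplication by a `(1, 1)`-form
`b` stop after two steps, so `c^{p+1}(b ζ)`, for `ζ` of bidegree `(p, p)`, has only a trace term and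
an interior product term (`contraction_pow_doubleForm11_mul`). With `b = g` this removes the powers
of the metric, and `*(g^{n-p} ζ / (n-p)!) = c^p ζ / p!`. With `b = B_N`, `ζ = R^k` and `p = 2k`, the
two terms are exactly the two terms of `T_{2k}` paired with `B_N`
(`scalarPart_doubleStar_eq_doubleInner`). Of the curvature tensor only its bidegree `(2, 2)` matters
here. -/

noncomputable section

namespace GaussBonnet

/-! ### The commutation relations of the contraction -/

section Algebra

variable {n : ℕ}

/-- Exterior multiplication by a covector on the left. -/
def wedge : Covec n →ₗ[ℝ] Module.End ℝ (Forms n) :=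
  (LinearMap.mul ℝ (Forms n)).comp (ExteriorAlgebra.ι ℝ)

lemma wedge_apply (α : Covec n) (θ : Forms n) : wedge α θ = ExteriorAlgebra.ι ℝ α * θ := rfl

lemma vecInterior_wedge (v : Vec n) (α : Covec n) (θ : Forms n) :
    vecInterior v (wedge α θ) = α v • θ - wedge α (vecInterior v θ) :=
  CliffordAlgebra.contractLeft_ι_mul _ _ _

lemma vecInterior_ι_mul (v : Vec n) (α : Covec n) (θ : Forms n) :
    vecInterior v (ExteriorAlgebra.ι ℝ α * θ)
      = α v • θ - ExteriorAlgebra.ι ℝ α * vecInterior v θ :=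
  CliffordAlgebra.contractLeft_ι_mul _ _ _

lemma vecInterior_algebraMap (v : Vec n) (r : ℝ) :
    vecInterior v (algebraMap ℝ (Forms n) r) = 0 :=
  CliffordAlgebra.contractLeft_algebraMap _ _ _

lemma vecInterior_ι (v : Vec n) (α : Covec n) :
    vecInterior v (ExteriorAlgebra.ι ℝ α) = algebraMap ℝ (Forms n) (α v) :=
  CliffordAlgebra.contractLeft_ι _ _ _

lemma vecInterior_comm (u v : Vec n) (θ : Forms n) :
    vecInterior u (vecInterior v θ) = - vecInterior v (vecInterior u θ) :=
  CliffordAlgebra.contractLeft_comm _ _ _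

lemma basisCovec_apply (i : Fin n) (v : Vec n) : basisCovec i v = v i := rfl

lemma basisCovec_basisVec (i j : Fin n) :
    basisCovec i (basisVec j) = if i = j then (1 : ℝ) else 0 := by
  simp [basisCovec_apply, basisVec]

lemma covec_apply (α : Covec n) (v : Vec n) : α v = ∑ i, v i * α (basisVec i) := by
  conv_lhs => rw [← (EuclideanSpace.basisFun (Fin n) ℝ).sum_repr v]
  simp [basisVec]

lemma covec_eq_sum (α : Covec n) : α = ∑ i, α (basisVec i) • basisCovec i := by
  ext v
  rw [covec_apply]
  simp [basisCovec_apply, mul_comm]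

variable (G : Matrix (Fin n) (Fin n) ℝ)

lemma sharp_apply (α : Covec n) :
    sharp G α = ∑ i, ∑ j, (G⁻¹ i j * α (basisVec j)) • basisVec i := by
  simp [sharp, LinearMap.sum_apply, smul_smul]

lemma inv_apply_comm {G : Matrix (Fin n) (Fin n) ℝ} (hG : G.IsSymm) (i j : Fin n) :
    G⁻¹ i j = G⁻¹ j i := by
  have h : (G⁻¹).transpose = G⁻¹ := by rw [Matrix.transpose_nonsing_inv, hG.eq]
  exact congrFun (congrFun h j) i

lemma sharp_apply' {G : Matrix (Fin n) (Fin n) ℝ} (hG : G.IsSymm) (α : Covec n) :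
    sharp G α = ∑ i, ∑ j, (G⁻¹ i j * α (basisVec i)) • basisVec j := by
  rw [sharp_apply, Finset.sum_comm]
  simp only [inv_apply_comm hG]

/-- The inner product of two covectors. -/
def covecInner (α β : Covec n) : ℝ := β (sharp G α)

lemma covecInner_eq {G : Matrix (Fin n) (Fin n) ℝ} (hG : G.IsSymm) (α β : Covec n) :
    covecInner G α β = ∑ i, ∑ j, G⁻¹ i j * (α (basisVec i) * β (basisVec j)) := by
  simp [covecInner, sharp_apply' hG, mul_assoc]

lemma covecInner_comm {G : Matrix (Fin n) (Fin n) ℝ} (hG : G.IsSymm) (α β : Covec n) :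
    covecInner G α β = covecInner G β α := by
  rw [covecInner_eq hG, covecInner_eq hG, Finset.sum_comm]
  refine Finset.sum_congr rfl fun i _ => Finset.sum_congr rfl fun j _ => ?_
  rw [inv_apply_comm hG, mul_comm (α _)]

lemma contraction_tmul (θ η : Forms n) :
    contraction G (θ ⊗ₜ[ℝ] η)
      = ∑ i, ∑ j, G⁻¹ i j • (vecInterior (basisVec i) θ ⊗ₜ[ℝ] vecInterior (basisVec j) η) := by
  simp [contraction, LinearMap.sum_apply]

/-- Multiplication by the double form `α ⊗ β` on the left. -/
def wedge₂ (α β : Covec n) : Module.End ℝ (DoubleForms n) :=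
  TensorProduct.map (wedge α) (wedge β)

/-- The first order part of the commutator of the contraction with `wedge₂ α β`. -/
def mixedOp (α β : Covec n) : Module.End ℝ (DoubleForms n) :=
  TensorProduct.map LinearMap.id (wedge β ∘ₗ vecInterior (sharp G α))
    + TensorProduct.map (wedge α ∘ₗ vecInterior (sharp G β)) LinearMap.id

/-- The interior product with the transpose of the double form `α ⊗ β`. -/
def interior₂ (α β : Covec n) : Module.End ℝ (DoubleForms n) :=
  TensorProduct.map (vecInterior (sharp G β)) (vecInterior (sharp G α))

variable {G}

/-- The antiderivation rule in both factors gives four products: neither, one or both of the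
interior products hit the new covectors. Those with exactly one hit form `mixedOp`, because `∑
G^{ij} α_i ∂_j = α♯`. -/
lemma contraction_mul_wedge₂ (hG : G.IsSymm) (α β : Covec n) :
    contraction G * wedge₂ α β
      = wedge₂ α β * contraction G + covecInner G α β • 1 - mixedOp G α β := by
  refine TensorProduct.ext' fun θ η => ?_
  simp only [Module.End.mul_apply, LinearMap.sub_apply, LinearMap.add_apply, LinearMap.smul_apply,
    wedge₂, mixedOp, TensorProduct.map_tmul, contraction_tmul, Module.End.one_apply,
    LinearMap.id_apply, LinearMap.comp_apply, covecInner_eq hG]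
  rw [sharp_apply' hG α, sharp_apply G β]
  simp only [map_sum, map_smul, LinearMap.sum_apply, LinearMap.smul_apply, TensorProduct.sum_tmul,
    TensorProduct.tmul_sum, Finset.sum_smul, vecInterior_wedge, TensorProduct.map_tmul]
  simp only [← Finset.sum_add_distrib, ← Finset.sum_sub_distrib]
  refine Finset.sum_congr rfl fun i _ => Finset.sum_congr rfl fun j _ => ?_
  simp only [TensorProduct.sub_tmul, TensorProduct.tmul_sub, ← TensorProduct.smul_tmul',
    TensorProduct.tmul_smul]
  module

/-- Interior products anticommute, and the signs from the two factors cancel. -/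
lemma contraction_mul_interior₂ (α β : Covec n) :
    contraction G * interior₂ G α β = interior₂ G α β * contraction G := by
  refine TensorProduct.ext' fun θ η => ?_
  simp only [Module.End.mul_apply, interior₂, TensorProduct.map_tmul, contraction_tmul, map_sum,
    map_smul]
  refine Finset.sum_congr rfl fun i _ => Finset.sum_congr rfl fun j _ => ?_
  rw [vecInterior_comm, vecInterior_comm (basisVec j), TensorProduct.neg_tmul,
    TensorProduct.tmul_neg, neg_neg]

/-- Each summand of `mixedOp` holds one exterior factor, and contracting it yields one copy of
`interior₂`; hence the factor 2. In the remaining terms the interior product passes two odd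
operators, without a sign. -/
lemma contraction_mul_mixedOp (hG : G.IsSymm) (α β : Covec n) :
    contraction G * mixedOp G α β
      = mixedOp G α β * contraction G + (2 : ℝ) • interior₂ G α β := by
  refine TensorProduct.ext' fun θ η => ?_
  have h1 : interior₂ G α β (θ ⊗ₜ η) = ∑ i, ∑ j, G⁻¹ i j • α (basisVec i) •
      (vecInterior (sharp G β) θ ⊗ₜ[ℝ] vecInterior (basisVec j) η) := by
    rw [interior₂, TensorProduct.map_tmul, sharp_apply' hG α]
    simp only [map_sum, map_smul, LinearMap.sum_apply, LinearMap.smul_apply,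
      TensorProduct.tmul_sum, TensorProduct.tmul_smul, smul_smul]
  have h2 : interior₂ G α β (θ ⊗ₜ η) = ∑ i, ∑ j, G⁻¹ i j • β (basisVec j) •
      (vecInterior (basisVec i) θ ⊗ₜ[ℝ] vecInterior (sharp G α) η) := by
    rw [interior₂, TensorProduct.map_tmul, sharp_apply G β]
    simp only [map_sum, map_smul, LinearMap.sum_apply, LinearMap.smul_apply,
      TensorProduct.sum_tmul, ← TensorProduct.smul_tmul', smul_smul]
  have h3 (j : Fin n) :
      vecInterior (basisVec j) (wedge β (vecInterior (sharp G α) η))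
        = β (basisVec j) • vecInterior (sharp G α) η
          + wedge β (vecInterior (sharp G α) (vecInterior (basisVec j) η)) := by
    rw [vecInterior_wedge, vecInterior_comm, map_neg, sub_neg_eq_add]
  have h4 (i : Fin n) :
      vecInterior (basisVec i) (wedge α (vecInterior (sharp G β) θ))
        = α (basisVec i) • vecInterior (sharp G β) θ
          + wedge α (vecInterior (sharp G β) (vecInterior (basisVec i) θ)) := by
    rw [vecInterior_wedge, vecInterior_comm, map_neg, sub_neg_eq_add]
  rw [two_smul, LinearMap.add_apply, LinearMap.add_apply]
  nth_rewrite 1 [h1]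
  rw [h2]
  simp only [Module.End.mul_apply, LinearMap.add_apply, mixedOp, TensorProduct.map_tmul,
    contraction_tmul, LinearMap.id_apply, LinearMap.comp_apply, map_add, map_sum, map_smul]
  simp only [← Finset.sum_add_distrib]
  refine Finset.sum_congr rfl fun i _ => Finset.sum_congr rfl fun j _ => ?_
  rw [h3 j, h4 i]
  simp only [TensorProduct.add_tmul, TensorProduct.tmul_add, ← TensorProduct.smul_tmul',
    TensorProduct.tmul_smul]
  module

/-- Moving a power of `c` across `L`, when `L` is of order two with respect to `c`. -/
lemma pow_mul_of_commutation {A : Type*} [Ring A] [Algebra ℝ A] {c L E I : A} {t : ℝ}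
    (hL : c * L = L * c + t • 1 - E) (hE : c * E = E * c + (2 : ℝ) • I) (hI : c * I = I * c)
    (q : ℕ) :
    c ^ (q + 2) * L = L * c ^ (q + 2) + ((q : ℝ) + 2) • ((t • 1 - E) * c ^ (q + 1))
      - (((q : ℝ) + 2) * (q + 1)) • (I * c ^ q) := by
  -- This is Leibniz's rule `c^p L = ∑ (p choose j) ad_c^j(L) c^{p-j}` for `p = q + 2`. It stops at
  -- `j = 2`, where `ad_c² L = -2 I` gives the coefficient `-p (p - 1)`.
  induction q with
  | zero =>
    have h : c * (c * L) = L * c * c + (2 * t) • c - (2 : ℝ) • (E * c) - (2 : ℝ) • I := by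
      rw [hL, mul_sub, mul_add, ← mul_assoc, hL, hE, mul_smul_comm, mul_one, sub_mul, add_mul,
        smul_mul_assoc, one_mul]
      module
    simp only [zero_add, pow_two, pow_one, pow_zero, mul_one, Nat.cast_zero, sub_mul,
      smul_mul_assoc, one_mul, ← mul_assoc] at h ⊢
    rw [h]
    module
  | succ q ih =>
    have hc : c * c ^ (q + 1) = c ^ (q + 2) := (pow_succ' c (q + 1)).symm
    have hc' : c * c ^ (q + 2) = c ^ (q + 3) := (pow_succ' c (q + 2)).symm
    have hc'' : c * c ^ q = c ^ (q + 1) := (pow_succ' c q).symm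
    have h1 : c * (L * c ^ (q + 2)) = L * c ^ (q + 3) + t • c ^ (q + 2) - E * c ^ (q + 2) := by
      rw [← mul_assoc, hL, sub_mul, add_mul, smul_mul_assoc, one_mul, mul_assoc, hc']
    have h2 : c * (E * c ^ (q + 1)) = E * c ^ (q + 2) + (2 : ℝ) • (I * c ^ (q + 1)) := by
      rw [← mul_assoc, hE, add_mul, smul_mul_assoc, mul_assoc, hc]
    have h3 : c * (I * c ^ q) = I * c ^ (q + 1) := by
      rw [← mul_assoc, hI, mul_assoc, hc'']
    rw [show q + 1 + 2 = (q + 2) + 1 from rfl, pow_succ' c (q + 2), mul_assoc, ih]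
    simp only [mul_sub, mul_add, sub_mul, smul_mul_assoc, one_mul, mul_smul_comm, h1, h2, h3, hc]
    push_cast
    rw [hc', show q + 1 + 1 = q + 2 from rfl]
    module

end Algebra

/-! ### Double forms of bidegree `(p, p)` -/

section Bidegree

variable {n : ℕ}

/-- The double forms of bidegree `(p, p)`. -/
def bidegree (n p : ℕ) : Submodule ℝ (DoubleForms n) :=
  Submodule.map₂ (TensorProduct.mk ℝ (Forms n) (Forms n)) (⋀[ℝ]^p (Covec n)) (⋀[ℝ]^p (Covec n))

lemma tmul_mem_bidegree {p : ℕ} {θ η : Forms n} (hθ : θ ∈ ⋀[ℝ]^p (Covec n))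
    (hη : η ∈ ⋀[ℝ]^p (Covec n)) : θ ⊗ₜ[ℝ] η ∈ bidegree n p :=
  Submodule.apply_mem_map₂ _ hθ hη

lemma bidegree_le {p : ℕ} {S : Submodule ℝ (DoubleForms n)}
    (h : ∀ θ ∈ ⋀[ℝ]^p (Covec n), ∀ η ∈ ⋀[ℝ]^p (Covec n), θ ⊗ₜ[ℝ] η ∈ S) : bidegree n p ≤ S :=
  Submodule.map₂_le.2 h

lemma linearMap_ext_bidegree {p : ℕ} {W : Type*} [AddCommGroup W] [Module ℝ W]
    {A B : DoubleForms n →ₗ[ℝ] W}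
    (h : ∀ θ ∈ ⋀[ℝ]^p (Covec n), ∀ η ∈ ⋀[ℝ]^p (Covec n), A (θ ⊗ₜ[ℝ] η) = B (θ ⊗ₜ[ℝ] η))
    {ζ : DoubleForms n} (hζ : ζ ∈ bidegree n p) : A ζ = B ζ :=
  bidegree_le (S := LinearMap.eqLocus A B) h hζ

lemma ι_mem_exteriorPower (α : Covec n) : ExteriorAlgebra.ι ℝ α ∈ ⋀[ℝ]^1 (Covec n) := by
  rw [ExteriorAlgebra.exteriorPower, pow_one]
  exact LinearMap.mem_range_self _ _

lemma mul_mem_bidegree {p q : ℕ} {ζ χ : DoubleForms n} (hζ : ζ ∈ bidegree n p)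
    (hχ : χ ∈ bidegree n q) : ζ * χ ∈ bidegree n (p + q) := by
  refine bidegree_le (S := (bidegree n (p + q)).comap (LinearMap.mulRight ℝ χ))
    (fun θ hθ η hη => ?_) hζ
  refine bidegree_le (S := (bidegree n (p + q)).comap (LinearMap.mulLeft ℝ (θ ⊗ₜ[ℝ] η)))
    (fun θ' hθ' η' hη' => ?_) hχ
  simp only [Submodule.mem_comap, LinearMap.mulLeft_apply, Algebra.TensorProduct.tmul_mul_tmul]
  refine tmul_mem_bidegree ?_ ?_ <;> rw [ExteriorAlgebra.exteriorPower, pow_add]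
  · exact Submodule.mul_mem_mul hθ hθ'
  · exact Submodule.mul_mem_mul hη hη'

lemma one_mem_bidegree : (1 : DoubleForms n) ∈ bidegree n 0 := by
  refine tmul_mem_bidegree ?_ ?_ <;> rw [ExteriorAlgebra.exteriorPower, pow_zero] <;>
    exact Submodule.one_le.1 le_rfl

lemma pow_mem_bidegree {p : ℕ} {ζ : DoubleForms n} (hζ : ζ ∈ bidegree n p) (k : ℕ) :
    ζ ^ k ∈ bidegree n (p * k) := by
  induction k with
  | zero => simpa using one_mem_bidegree
  | succ k ih => rw [pow_succ, Nat.mul_succ]; exact mul_mem_bidegree ih hζ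

lemma doubleForm11_mem (b : Fin n → Fin n → ℝ) : doubleForm11 b ∈ bidegree n 1 :=
  Submodule.sum_mem _ fun _ _ => Submodule.sum_mem _ fun _ _ => Submodule.smul_mem _ _
    (tmul_mem_bidegree (ι_mem_exteriorPower _) (ι_mem_exteriorPower _))

lemma doubleForm22_mem (r : Fin n → Fin n → Fin n → Fin n → ℝ) :
    doubleForm22 r ∈ bidegree n 2 := by
  refine Submodule.smul_mem _ _ (Submodule.sum_mem _ fun _ _ => Submodule.sum_mem _ fun _ _ =>
    Submodule.sum_mem _ fun _ _ => Submodule.sum_mem _ fun _ _ => Submodule.smul_mem _ _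
    (tmul_mem_bidegree ?_ ?_)) <;>
  · rw [ExteriorAlgebra.exteriorPower, pow_two]
    refine Submodule.mul_mem_mul ?_ ?_ <;> exact LinearMap.mem_range_self _ _

lemma vecInterior_of_mem_zero (v : Vec n) {θ : Forms n} (hθ : θ ∈ ⋀[ℝ]^0 (Covec n)) :
    vecInterior v θ = 0 := by
  rw [ExteriorAlgebra.exteriorPower, pow_zero, Submodule.mem_one] at hθ
  obtain ⟨r, rfl⟩ := hθ
  exact vecInterior_algebraMap v r

lemma vecInterior_mem (v : Vec n) {p : ℕ} {θ : Forms n} (hθ : θ ∈ ⋀[ℝ]^(p + 1) (Covec n)) :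
    vecInterior v θ ∈ ⋀[ℝ]^p (Covec n) := by
  induction p generalizing θ with
  | zero =>
    rw [ExteriorAlgebra.exteriorPower, zero_add, pow_one] at hθ
    obtain ⟨α, rfl⟩ := hθ
    rw [vecInterior_ι, ExteriorAlgebra.exteriorPower, pow_zero]
    exact Submodule.mem_one.2 ⟨_, rfl⟩
  | succ p ih =>
    rw [ExteriorAlgebra.exteriorPower, pow_succ'] at hθ
    suffices h : LinearMap.range (ExteriorAlgebra.ι ℝ) * ⋀[ℝ]^(p + 1) (Covec n)
        ≤ (⋀[ℝ]^(p + 1) (Covec n)).comap (vecInterior v) from h hθ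
    refine Submodule.mul_le.2 ?_
    rintro _ ⟨α, rfl⟩ η hη
    rw [Submodule.mem_comap, vecInterior_ι_mul]
    refine Submodule.sub_mem _ (Submodule.smul_mem _ _ hη) ?_
    rw [ExteriorAlgebra.exteriorPower, pow_succ']
    exact Submodule.mul_mem_mul (LinearMap.mem_range_self _ _) (ih hη)

variable (G : Matrix (Fin n) (Fin n) ℝ)

lemma contraction_of_mem_zero {ζ : DoubleForms n} (hζ : ζ ∈ bidegree n 0) :
    contraction G ζ = 0 := by
  refine linearMap_ext_bidegree (B := 0) (fun θ hθ η hη => ?_) hζ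
  simp [contraction_tmul, vecInterior_of_mem_zero _ hθ]

lemma contraction_mem {p : ℕ} {ζ : DoubleForms n} (hζ : ζ ∈ bidegree n (p + 1)) :
    contraction G ζ ∈ bidegree n p := by
  refine bidegree_le (S := (bidegree n p).comap (contraction G)) (fun θ hθ η hη => ?_) hζ
  rw [Submodule.mem_comap, contraction_tmul]
  exact Submodule.sum_mem _ fun _ _ => Submodule.sum_mem _ fun _ _ => Submodule.smul_mem _ _
    (tmul_mem_bidegree (vecInterior_mem _ hθ) (vecInterior_mem _ hη))

lemma contraction_pow_mem {p q : ℕ} {ζ : DoubleForms n} (hζ : ζ ∈ bidegree n (p + q)) :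
    (contraction G ^ q) ζ ∈ bidegree n p := by
  induction q generalizing ζ with
  | zero => simpa using hζ
  | succ q ih => rw [pow_succ]; exact ih (contraction_mem G hζ)

lemma contraction_pow_mem_zero {p : ℕ} {ζ : DoubleForms n} (hζ : ζ ∈ bidegree n p) :
    (contraction G ^ p) ζ ∈ bidegree n 0 :=
  contraction_pow_mem G (by rwa [zero_add])

lemma contraction_pow_succ_eq_zero {p : ℕ} {ζ : DoubleForms n} (hζ : ζ ∈ bidegree n p) :
    (contraction G ^ (p + 1)) ζ = 0 := by
  rw [pow_succ']
  exact contraction_of_mem_zero G (contraction_pow_mem_zero G hζ)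

lemma mixedOp_of_mem_zero (α β : Covec n) {ζ : DoubleForms n} (hζ : ζ ∈ bidegree n 0) :
    mixedOp G α β ζ = 0 := by
  refine linearMap_ext_bidegree (B := 0) (fun θ hθ η hη => ?_) hζ
  simp [mixedOp, vecInterior_of_mem_zero _ hθ, vecInterior_of_mem_zero _ hη]

lemma wedge₂_apply (α β : Covec n) (ζ : DoubleForms n) :
    wedge₂ α β ζ = (ExteriorAlgebra.ι ℝ α ⊗ₜ[ℝ] ExteriorAlgebra.ι ℝ β) * ζ := by
  refine LinearMap.congr_fun (g := LinearMap.mulLeft ℝ _) (TensorProduct.ext' fun θ η => ?_) ζ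
  simp [wedge₂, wedge_apply]

variable {G}

/-- In `pow_mul_of_commutation` two terms vanish for degree reasons: `c^{p+1} ζ = 0`, and `mixedOp`
kills the bidegree `(0, 0)` form `c^p ζ`. At `p = 0` the truncated exponent `p - 1` is harmless,
since its coefficient is zero. -/
lemma contraction_pow_wedge₂ (hG : G.IsSymm) (α β : Covec n) {p : ℕ} {ζ : DoubleForms n}
    (hζ : ζ ∈ bidegree n p) :
    (contraction G ^ (p + 1)) (wedge₂ α β ζ)
      = (((p : ℝ) + 1) * covecInner G α β) • (contraction G ^ p) ζ
        - (((p : ℝ) + 1) * p) • interior₂ G α β ((contraction G ^ (p - 1)) ζ) := by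
  cases p with
  | zero =>
    have h := LinearMap.congr_fun (contraction_mul_wedge₂ hG α β) ζ
    simp only [Module.End.mul_apply, LinearMap.sub_apply, LinearMap.add_apply,
      LinearMap.smul_apply, Module.End.one_apply, contraction_of_mem_zero G hζ,
      mixedOp_of_mem_zero G α β hζ] at h
    simp [h]
  | succ q =>
    have h := LinearMap.congr_fun (pow_mul_of_commutation (contraction_mul_wedge₂ hG α β)
      (contraction_mul_mixedOp hG α β) (contraction_mul_interior₂ α β) q) ζ
    simp only [Module.End.mul_apply, LinearMap.sub_apply, LinearMap.add_apply,
      LinearMap.smul_apply, Module.End.one_apply, contraction_pow_succ_eq_zero G hζ,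
      mixedOp_of_mem_zero G α β (contraction_pow_mem_zero G hζ)] at h
    rw [show q + 1 + 1 = q + 2 from rfl, h]
    push_cast
    simp only [map_zero]
    module

/-! ### Products with a `(1, 1)`-form and with powers of the metric -/

variable (G)

/-- The trace of the bilinear form `b`. -/
def trace₂ (b : Fin n → Fin n → ℝ) : ℝ :=
  ∑ i, ∑ j, b i j * covecInner G (basisCovec i) (basisCovec j)

/-- The interior product with the transpose of the double form with components `b`. -/
def interior₁₁ (b : Fin n → Fin n → ℝ) : Module.End ℝ (DoubleForms n) :=
  ∑ i, ∑ j, b i j • interior₂ G (basisCovec i) (basisCovec j)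

variable {G}

lemma doubleForm11_mul (b : Fin n → Fin n → ℝ) (ζ : DoubleForms n) :
    doubleForm11 b * ζ = ∑ i, ∑ j, b i j • wedge₂ (basisCovec i) (basisCovec j) ζ := by
  simp only [doubleForm11, Finset.sum_mul, smul_mul_assoc, wedge₂_apply, basisForm]

/-- The top contraction of a product with a `(1, 1)`-double form. -/
lemma contraction_pow_doubleForm11_mul (hG : G.IsSymm) (b : Fin n → Fin n → ℝ) {p : ℕ}
    {ζ : DoubleForms n} (hζ : ζ ∈ bidegree n p) :
    (contraction G ^ (p + 1)) (doubleForm11 b * ζ)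
      = (((p : ℝ) + 1) * trace₂ G b) • (contraction G ^ p) ζ
        - (((p : ℝ) + 1) * p) • interior₁₁ G b ((contraction G ^ (p - 1)) ζ) := by
  simp only [doubleForm11_mul, map_sum, map_smul, contraction_pow_wedge₂ hG _ _ hζ, trace₂,
    interior₁₁, LinearMap.sum_apply, LinearMap.smul_apply, Finset.mul_sum, Finset.sum_smul,
    Finset.smul_sum]
  simp only [← Finset.sum_sub_distrib]
  refine Finset.sum_congr rfl fun i _ => Finset.sum_congr rfl fun j _ => ?_
  module

lemma sharp_basisCovec (j : Fin n) : sharp G (basisCovec j) = ∑ i, G⁻¹ i j • basisVec i := by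
  rw [sharp_apply]
  simp [basisCovec_basisVec]

lemma covecInner_basisCovec (hG : G.IsSymm) (i j : Fin n) :
    covecInner G (basisCovec i) (basisCovec j) = G⁻¹ i j := by
  rw [covecInner_eq hG]
  simp [basisCovec_basisVec]

lemma trace₂_self (hG : G.IsSymm) (hd : IsUnit G.det) : trace₂ G (fun i j => G i j) = n := by
  have h : (G⁻¹ * G).trace = n := by rw [Matrix.nonsing_inv_mul _ hd]; simp
  rw [← h]
  simp only [trace₂, covecInner_basisCovec hG, Matrix.trace, Matrix.diag, Matrix.mul_apply]
  refine Finset.sum_congr rfl fun i _ => Finset.sum_congr rfl fun j _ => ?_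
  rw [hG.apply, mul_comm]

lemma sum_smul_sharp_basisCovec (hG : G.IsSymm) (hd : IsUnit G.det) (i : Fin n) :
    ∑ j, G i j • sharp G (basisCovec j) = basisVec i := by
  simp only [sharp_basisCovec, Finset.smul_sum, smul_smul]
  rw [Finset.sum_comm]
  have h (k : Fin n) : ∑ j, (G i j * G⁻¹ k j) • (basisVec k : Vec n)
      = if i = k then basisVec k else 0 := by
    rw [← Finset.sum_smul]
    simp only [inv_apply_comm hG k]
    rw [← Matrix.mul_apply, Matrix.mul_nonsing_inv _ hd, Matrix.one_apply]
    split_ifs <;> simp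
  simp [h]

/-- Lowering an index with `G` undoes one of the two sharps, which leaves `∑ ι(e_i) ⊗ ι((eⁱ)♯) = c`.
-/
lemma interior₁₁_self (hG : G.IsSymm) (hd : IsUnit G.det) :
    interior₁₁ G (fun i j => G i j) = contraction G := by
  refine TensorProduct.ext' fun θ η => ?_
  have h (i : Fin n) : ∑ j, G i j • interior₂ G (basisCovec i) (basisCovec j) (θ ⊗ₜ[ℝ] η)
      = ∑ j, G⁻¹ i j • (vecInterior (basisVec i) θ ⊗ₜ[ℝ] vecInterior (basisVec j) η) := by
    conv_rhs => rw [← sum_smul_sharp_basisCovec hG hd i]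
    simp only [interior₂, TensorProduct.map_tmul, sharp_basisCovec i, inv_apply_comm hG _ i,
      map_sum, map_smul, LinearMap.sum_apply, LinearMap.smul_apply, TensorProduct.sum_tmul,
      TensorProduct.tmul_sum, TensorProduct.tmul_smul, ← TensorProduct.smul_tmul',
      Finset.smul_sum]
    rw [Finset.sum_comm]
    refine Finset.sum_congr rfl fun i _ => Finset.sum_congr rfl fun j _ => smul_comm _ _ _
  simp only [interior₁₁, LinearMap.sum_apply, LinearMap.smul_apply, h, contraction_tmul]

variable (G) in
/-- The inner product with Gram matrix `G`, as a `(1, 1)`-double form. -/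
def metric₁₁ : DoubleForms n := doubleForm11 fun i j => G i j

/-- For `b = g` the trace is `n` and the interior product is `c` itself, so both terms are multiples
of `c^p ζ`, with total coefficient `(p + 1) n - (p + 1) p`. -/
lemma contraction_pow_metric_mul (hG : G.IsSymm) (hd : IsUnit G.det) {p : ℕ}
    {ζ : DoubleForms n} (hζ : ζ ∈ bidegree n p) :
    (contraction G ^ (p + 1)) (metric₁₁ G * ζ)
      = (((p : ℝ) + 1) * (n - p)) • (contraction G ^ p) ζ := by
  rw [metric₁₁, contraction_pow_doubleForm11_mul hG _ hζ, trace₂_self hG hd, interior₁₁_self hG hd]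
  cases p with
  | zero => simp
  | succ p =>
    rw [Nat.add_sub_cancel, ← Module.End.mul_apply, ← pow_succ']
    module

/-- The complete contraction of a product with a power of the metric. -/
lemma contraction_pow_metric_pow_mul (hG : G.IsSymm) (hd : IsUnit G.det) {p : ℕ}
    {ζ : DoubleForms n} (hζ : ζ ∈ bidegree n p) (r d : ℕ) (hr : p + r + d = n) :
    ((d.factorial * p.factorial : ℕ) : ℝ) • (contraction G ^ (r + p)) (metric₁₁ G ^ r * ζ)
      = (((r + p).factorial * (r + d).factorial : ℕ) : ℝ) • (contraction G ^ p) ζ := by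
  induction r generalizing d with
  | zero => simp [mul_comm]
  | succ r ih =>
    have hm : metric₁₁ G ^ r * ζ ∈ bidegree n (r + p) := by
      have : metric₁₁ G ^ r ∈ _ := pow_mem_bidegree (doubleForm11_mem fun i j => G i j) r
      rw [one_mul] at this
      exact mul_mem_bidegree this hζ
    -- `d` is the codegree `n - p - r`; one metric factor fewer leaves codegree `d + 1`, and this is
    -- the factor `n - (r + p)` gained at this step.
    have h := ih (d + 1) (by omega)
    have hn : (n : ℝ) - (r + p : ℕ) = d + 1 := by
      rw [← hr]; push_cast; ring
    rw [show r + 1 + p = r + p + 1 by omega, pow_succ' (metric₁₁ G), mul_assoc,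
      contraction_pow_metric_mul hG hd hm, hn, show r + 1 + d = r + (d + 1) by omega,
      Nat.factorial_succ (r + p), mul_assoc (r + p + 1), Nat.cast_mul (r + p + 1),
      mul_smul _ _ ((contraction G ^ p) ζ), ← h, Nat.factorial_succ d]
    push_cast
    module

end Bidegree

/-! ### The Hodge star on top degree double forms -/

section Star

variable {n : ℕ}

/-- The covector with the given components. -/
def covecOf : (Fin n → ℝ) →ₗ[ℝ] Covec n := Fintype.linearCombination ℝ basisCovec

lemma covecOf_apply (w : Fin n → ℝ) : covecOf w = ∑ i, w i • basisCovec i :=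
  Fintype.linearCombination_apply _ _ _

lemma covecOf_components (α : Covec n) : covecOf (fun i => α (basisVec i)) = α := by
  rw [covecOf_apply, ← covec_eq_sum]

lemma covecOf_single (i : Fin n) : covecOf (Pi.single i 1) = basisCovec i := by
  simp [covecOf_apply, Pi.single_apply]

/-- The form `e¹ ∧ ⋯ ∧ eⁿ`. -/
def topForm (n : ℕ) : Forms n := ExteriorAlgebra.ιMulti ℝ n fun i : Fin n => basisCovec i

/-- Both sides are alternating in the rows of `A`, so it suffices to compare them on permutations of
the standard basis. -/
lemma ιMulti_covecOf (A : Matrix (Fin n) (Fin n) ℝ) :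
    ExteriorAlgebra.ιMulti ℝ n (fun a => covecOf (A a)) = A.det • topForm n := by
  have h : (ExteriorAlgebra.ιMulti ℝ n).compLinearMap (covecOf (n := n))
      = (LinearMap.toSpanSingleton ℝ (Forms n) (topForm n)).compAlternatingMap
        Matrix.detRowAlternating := by
    refine Module.Basis.ext_alternating (Pi.basisFun ℝ (Fin n)) fun v hv => ?_
    have hb : Function.Bijective v := Finite.injective_iff_bijective.1 hv
    obtain ⟨σ, rfl⟩ : ∃ σ : Equiv.Perm (Fin n), v = σ := ⟨Equiv.ofBijective v hb, rfl⟩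
    have key (f : (Fin n → ℝ) [⋀^Fin n]→ₗ[ℝ] Forms n) :
        f (fun i => Pi.basisFun ℝ (Fin n) (σ i))
          = Equiv.Perm.sign σ • f (Pi.basisFun ℝ (Fin n)) := f.map_perm _ σ
    rw [key, key]
    congr 1
    have h1 : Matrix.detRowAlternating (Pi.basisFun ℝ (Fin n)) = (1 : ℝ) := by
      have : (Pi.basisFun ℝ (Fin n) : Fin n → Fin n → ℝ) = (1 : Matrix (Fin n) (Fin n) ℝ) := by
        ext i j; simp [Matrix.one_apply, Pi.single_apply, eq_comm]
      rw [this]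
      exact Matrix.det_one
    simp [h1, topForm, covecOf_single]
  exact DFunLike.congr_fun h A

lemma mem_exteriorPower_top {θ : Forms n} (hθ : θ ∈ ⋀[ℝ]^n (Covec n)) :
    ∃ r : ℝ, r • topForm n = θ := by
  rw [← Submodule.mem_span_singleton]
  rw [← ExteriorAlgebra.ιMulti_span_fixedDegree] at hθ
  refine Submodule.span_le.2 ?_ hθ
  rintro _ ⟨v, rfl⟩
  refine Submodule.mem_span_singleton.2 ⟨(Matrix.of fun a i => v a (basisVec i)).det, ?_⟩
  rw [← ιMulti_covecOf]
  congr 1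
  exact funext fun a => covecOf_components (v a)

variable (G : Matrix (Fin n) (Fin n) ℝ)

lemma formInterior_one : formInterior G 1 = 1 := by
  simp [formInterior]

lemma formInterior_ι_mul (α : Covec n) (χ : Forms n) :
    formInterior G (ExteriorAlgebra.ι ℝ α * χ) = formInterior G χ * vecInterior (sharp G α) := by
  simp [formInterior]

variable {G}

lemma contraction_tmul_sharp (hG : G.IsSymm) (θ η : Forms n) :
    contraction G (θ ⊗ₜ[ℝ] η) = ∑ i, vecInterior (basisVec i) θ ⊗ₜ[ℝ]
      vecInterior (sharp G (basisCovec i)) η := by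
  rw [contraction_tmul]
  simp only [sharp_basisCovec, map_sum, map_smul, LinearMap.sum_apply, LinearMap.smul_apply,
    TensorProduct.tmul_sum, TensorProduct.tmul_smul, inv_apply_comm hG]

lemma sharp_covecOf (hG : G.IsSymm) (hd : IsUnit G.det) (i : Fin n) :
    sharp G (covecOf (G i)) = basisVec i := by
  simp only [covecOf_apply, map_sum, map_smul, sum_smul_sharp_basisCovec hG hd]

/-- Writes `c^q` through `formInterior`, by which the Hodge star is defined. As the frame need not
be orthonormal, `∂_i` is paired with `(eⁱ)♯`, and `∂_i` itself is the sharp of row `i` of `G`. -/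
lemma contraction_pow_tmul (hG : G.IsSymm) (hd : IsUnit G.det) (q : ℕ) (θ η : Forms n) :
    (contraction G ^ q) (θ ⊗ₜ[ℝ] η) = ∑ s : Fin q → Fin n,
      formInterior G (ExteriorAlgebra.ιMulti ℝ q fun a => covecOf (G (s a))) θ ⊗ₜ[ℝ]
        formInterior G (ExteriorAlgebra.ιMulti ℝ q fun a => basisCovec (s a)) η := by
  induction q generalizing θ η with
  | zero => simp [formInterior_one]
  | succ q ih =>
    rw [pow_succ, Module.End.mul_apply, contraction_tmul_sharp hG, map_sum,
      ← (Fin.consEquiv fun _ : Fin (q + 1) => Fin n).sum_comp, Fintype.sum_prod_type]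
    refine Finset.sum_congr rfl fun i _ => ?_
    rw [ih]
    refine Finset.sum_congr rfl fun s _ => ?_
    simp only [ExteriorAlgebra.ιMulti_succ_apply, formInterior_ι_mul, Module.End.mul_apply,
      Fin.consEquiv_apply, Fin.cons_zero, sharp_covecOf hG hd, Matrix.vecTail, Function.comp_def,
      Fin.cons_succ]

/-- Non-injective index maps repeat a row and contribute 0; each of the `n!` permutations
contributes its squared sign. -/
lemma sum_det_submatrix_one_sq :
    ∑ s : Fin n → Fin n, ((1 : Matrix (Fin n) (Fin n) ℝ).submatrix s id).det ^ 2
      = n.factorial := by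
  classical
  have h (s : Fin n → Fin n) : ((1 : Matrix (Fin n) (Fin n) ℝ).submatrix s id).det ^ 2
      = if Function.Injective s then 1 else 0 := by
    split_ifs with hs
    · obtain ⟨σ, rfl⟩ : ∃ σ : Equiv.Perm (Fin n), s = σ :=
        ⟨Equiv.ofBijective s (Finite.injective_iff_bijective.1 hs), rfl⟩
      rw [Matrix.det_permute, Matrix.det_one, mul_one]
      rcases Int.units_eq_one_or (Equiv.Perm.sign σ) with h | h <;> simp [h]
    · simp only [Function.Injective, not_forall] at hs
      obtain ⟨a, b, hab, hne⟩ := hs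
      rw [Matrix.det_zero_of_row_eq hne (by
        ext j; rw [Matrix.submatrix_apply, Matrix.submatrix_apply, hab])]
      simp
  simp only [h, Finset.sum_boole]
  rw [← Fintype.card_subtype, Fintype.card_congr (Equiv.subtypeInjectiveEquivEmbedding _ _),
    Fintype.card_embedding_eq]
  simp [Nat.descFactorial_self]

lemma scalarPart_tmul (θ η : Forms n) :
    scalarPart (θ ⊗ₜ[ℝ] η)
      = ExteriorAlgebra.algebraMapInv θ * ExteriorAlgebra.algebraMapInv η := by
  simp [scalarPart]

/-- On double forms of top degree the Hodge star is the complete contraction. -/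
lemma scalarPart_doubleStar (hG : G.IsSymm) (hd : 0 < G.det) {ζ : DoubleForms n}
    (hζ : ζ ∈ bidegree n n) :
    (n.factorial : ℝ) * scalarPart (doubleStar G ζ) = scalarPart ((contraction G ^ n) ζ) := by
  have hu : IsUnit G.det := hd.ne'.isUnit
  refine linearMap_ext_bidegree
    (A := (n.factorial : ℝ) • scalarPart.toLinearMap ∘ₗ doubleStar G)
    (B := scalarPart.toLinearMap ∘ₗ (contraction G ^ n)) (fun θ hθ η hη => ?_) hζ
  obtain ⟨r, rfl⟩ := mem_exteriorPower_top hθ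
  obtain ⟨t, rfl⟩ := mem_exteriorPower_top hη
  simp only [← TensorProduct.smul_tmul', TensorProduct.tmul_smul, map_smul]
  congr 2
  have hs (s : Fin n → Fin n) :
      ExteriorAlgebra.ιMulti ℝ n (fun a => covecOf (G (s a)))
        = (((1 : Matrix (Fin n) (Fin n) ℝ).submatrix s id).det * G.det) • topForm n := by
    rw [← Matrix.det_mul, ← ιMulti_covecOf]
    congr 1
    funext a
    congr 1
    ext j
    simp [Matrix.mul_apply, Matrix.one_apply]
  have hs' (s : Fin n → Fin n) :
      ExteriorAlgebra.ιMulti ℝ n (fun a => basisCovec (s a))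
        = ((1 : Matrix (Fin n) (Fin n) ℝ).submatrix s id).det • topForm n := by
    rw [← ιMulti_covecOf]
    congr 1
    funext a
    rw [← covecOf_single]
    congr 1
    ext j
    simp [Matrix.one_apply, Pi.single_apply, eq_comm]
  have hv : volForm G = Real.sqrt G.det • topForm n := rfl
  simp only [LinearMap.smul_apply, LinearMap.comp_apply, AlgHom.toLinearMap_apply,
    contraction_pow_tmul hG hu, hs, hs', doubleStar, TensorProduct.map_tmul, hodgeStar,
    LinearMap.flip_apply, hv, map_smul, map_sum, scalarPart_tmul, smul_eq_mul,
    LinearMap.smul_apply]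
  -- The two volume forms contribute `√(det G)` each; their product matches the `det G` that comes
  -- from the lowered indices in `hs`.
  have hq := Real.mul_self_sqrt hd.le
  rw [← sum_det_submatrix_one_sq, Finset.sum_mul]
  refine Finset.sum_congr rfl fun s _ => ?_
  linear_combination (((1 : Matrix (Fin n) (Fin n) ℝ).submatrix s id).det ^ 2
    * ExteriorAlgebra.algebraMapInv (formInterior G (topForm n) (topForm n)) ^ 2) * hq

end Star

/-! ### The Einstein-Lovelock tensor and the complete contraction -/

section Lovelock

variable {n : ℕ} {G : Matrix (Fin n) (Fin n) ℝ}

lemma formInner_ι_ι (α β : Covec n) :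
    formInner G (ExteriorAlgebra.ι ℝ α) (ExteriorAlgebra.ι ℝ β) = covecInner G α β := by
  have h := formInterior_ι_mul G α 1
  rw [mul_one, formInterior_one, one_mul] at h
  simp [formInner, h, vecInterior_ι, covecInner]

lemma doubleInner_tmul (θ η θ' η' : Forms n) :
    doubleInner G (θ ⊗ₜ[ℝ] η) (θ' ⊗ₜ[ℝ] η') = formInner G θ θ' * formInner G η η' := by
  simp [doubleInner, mul_comm]

/-- `interior₁₁` contracts with the transpose of `b`, so the symmetry of `b` is what identifies it
with the inner product. -/
lemma doubleInner_doubleForm11 (hG : G.IsSymm) {b : Fin n → Fin n → ℝ} (hb : ∀ i j, b i j = b j i)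
    {ζ : DoubleForms n} (hζ : ζ ∈ bidegree n 1) :
    doubleInner G ζ (doubleForm11 b) = scalarPart (interior₁₁ G b ζ) := by
  refine linearMap_ext_bidegree
    (A := LinearMap.flip (doubleInner G) (doubleForm11 b))
    (B := scalarPart.toLinearMap ∘ₗ interior₁₁ G b) (fun θ hθ η hη => ?_) hζ
  rw [ExteriorAlgebra.exteriorPower, pow_one] at hθ hη
  obtain ⟨α, rfl⟩ := hθ
  obtain ⟨β, rfl⟩ := hη
  simp only [LinearMap.flip_apply, LinearMap.comp_apply, AlgHom.toLinearMap_apply, doubleForm11,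
    interior₁₁, map_sum, map_smul, LinearMap.sum_apply, LinearMap.smul_apply, doubleInner_tmul,
    interior₂, TensorProduct.map_tmul, scalarPart_tmul, vecInterior_ι, basisForm, formInner_ι_ι,
    AlgHom.commutes, Algebra.algebraMap_self_apply]
  rw [Finset.sum_comm]
  refine Finset.sum_congr rfl fun i _ => Finset.sum_congr rfl fun j _ => ?_
  rw [hb, covecInner_comm hG, covecInner_comm hG β]
  rfl

lemma doubleInner_metric₁₁ (hG : G.IsSymm) (hd : IsUnit G.det) (b : Fin n → Fin n → ℝ) :
    doubleInner G (metric₁₁ G) (doubleForm11 b) = trace₂ G b := by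
  have h (k l : Fin n) : ∑ i, ∑ j, G i j * (G⁻¹ i k * G⁻¹ j l) = G⁻¹ k l := by
    have h1 : (G⁻¹ * (G * G⁻¹)) k l = G⁻¹ k l := by
      rw [Matrix.mul_nonsing_inv _ hd, Matrix.mul_one]
    rw [← h1, Matrix.mul_apply]
    refine Finset.sum_congr rfl fun i _ => ?_
    rw [Matrix.mul_apply, Finset.mul_sum, inv_apply_comm hG k i]
    exact Finset.sum_congr rfl fun j _ => by ring
  simp only [metric₁₁, doubleForm11, trace₂, map_sum, map_smul, LinearMap.sum_apply,
    LinearMap.smul_apply, doubleInner_tmul, basisForm, formInner_ι_ι,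
    covecInner_basisCovec hG, smul_eq_mul]
  refine Finset.sum_congr rfl fun k _ => Finset.sum_congr rfl fun l _ => ?_
  rw [h]

/-- Moving a covector past a `p`-form costs `(-1)^p`; this happens once in each tensor factor, so
the signs cancel. -/
lemma commute_doubleForm11 (b : Fin n → Fin n → ℝ) {p : ℕ} {ζ : DoubleForms n}
    (hζ : ζ ∈ bidegree n p) : ζ * doubleForm11 b = doubleForm11 b * ζ := by
  have h (α : Covec n) {p : ℕ} {θ : Forms n} (hθ : θ ∈ ⋀[ℝ]^p (Covec n)) :
      θ * ExteriorAlgebra.ι ℝ α = (-1 : ℝ) ^ p • (ExteriorAlgebra.ι ℝ α * θ) := by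
    refine Submodule.pow_induction_on_left' _
      (C := fun p θ _ => θ * ExteriorAlgebra.ι ℝ α = (-1 : ℝ) ^ p • (ExteriorAlgebra.ι ℝ α * θ))
      (fun r => ?_) (fun x y i hx hy hx' hy' => ?_) (fun m hm i x hx hx' => ?_) hθ
    · simp [Algebra.commutes]
    · simp only [add_mul, mul_add, hx', hy', smul_add]
    · obtain ⟨β, rfl⟩ := hm
      have hc : ExteriorAlgebra.ι ℝ β * ExteriorAlgebra.ι ℝ α
          = - (ExteriorAlgebra.ι ℝ α * ExteriorAlgebra.ι ℝ β) :=
        eq_neg_of_add_eq_zero_left (ExteriorAlgebra.ι_add_mul_swap _ _)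
      rw [mul_assoc, hx', mul_smul_comm, ← mul_assoc, hc, ← mul_assoc, pow_succ]
      simp
  refine linearMap_ext_bidegree (A := LinearMap.mulRight ℝ (doubleForm11 b))
    (B := LinearMap.mulLeft ℝ (doubleForm11 b)) (fun θ hθ η hη => ?_) hζ
  simp only [LinearMap.mulRight_apply, LinearMap.mulLeft_apply, doubleForm11, Finset.mul_sum,
    Finset.sum_mul, mul_smul_comm, smul_mul_assoc, Algebra.TensorProduct.tmul_mul_tmul, basisForm,
    h _ hθ, h _ hη, TensorProduct.tmul_smul, ← TensorProduct.smul_tmul', smul_smul]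
  simp [← mul_pow]

/-- The Hodge star of `g^{n-p} ζ / (n-p)!`, for `ζ` of bidegree `(p, p)`. -/
lemma scalarPart_doubleStar_metric_pow_mul (hG : G.IsSymm) (hd : 0 < G.det) {p : ℕ}
    {ζ : DoubleForms n} (hζ : ζ ∈ bidegree n p) (hp : p ≤ n) :
    scalarPart (doubleStar G ((1 / (Nat.factorial (n - p) : ℝ)) • (metric₁₁ G ^ (n - p) * ζ)))
      = (p.factorial : ℝ)⁻¹ * scalarPart ((contraction G ^ p) ζ) := by
  have h1 : metric₁₁ G ^ (n - p) ∈ bidegree n (1 * (n - p)) :=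
    pow_mem_bidegree (doubleForm11_mem fun i j => G i j) _
  have h2 : metric₁₁ G ^ (n - p) * ζ ∈ bidegree n n := by
    have := mul_mem_bidegree h1 hζ
    rwa [one_mul, Nat.sub_add_cancel hp] at this
  -- Here `r = n - p`, so the codegree `d` is 0 and the left side carries the full power `c^n`,
  -- which is `n!` times the Hodge star.
  have h3 := congrArg scalarPart
    (contraction_pow_metric_pow_mul hG hd.ne'.isUnit hζ (n - p) 0 (by omega))
  rw [map_smul, map_smul, Nat.sub_add_cancel hp, ← scalarPart_doubleStar hG hd h2] at h3
  have hn : (n.factorial : ℝ) ≠ 0 := by exact_mod_cast n.factorial_ne_zero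
  have hp' : (p.factorial : ℝ) ≠ 0 := by exact_mod_cast p.factorial_ne_zero
  have hnp : ((n - p).factorial : ℝ) ≠ 0 := by exact_mod_cast (n - p).factorial_ne_zero
  simp only [map_smul, smul_eq_mul, Nat.factorial_zero, one_mul, add_zero] at h3 ⊢
  push_cast at h3
  field_simp
  refine mul_left_cancel₀ hn ?_
  linear_combination h3

/-- The complete contraction of `g^{n-2k-1} R^k b` is the inner product of `b` with the
Einstein-Lovelock tensor of `R`. -/
lemma scalarPart_doubleStar_eq_doubleInner (hG : G.IsSymm) (hd : 0 < G.det) {k : ℕ}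
    (hk : 2 * k < n) {R : DoubleForms n} (hR : R ∈ bidegree n 2) {b : Fin n → Fin n → ℝ}
    (hb : ∀ i j, b i j = b j i) :
    scalarPart (doubleStar G ((1 / (Nat.factorial (n - 2 * k - 1) : ℝ)) •
        (metric₁₁ G ^ (n - 2 * k - 1) * R ^ k * doubleForm11 b)))
      = doubleInner G (if k = 0 then metric₁₁ G else
          scalarPart (doubleStar G ((1 / (Nat.factorial (n - 2 * k) : ℝ)) •
            (metric₁₁ G ^ (n - 2 * k) * R ^ k))) • metric₁₁ G
          - (1 / (Nat.factorial (2 * k - 1) : ℝ)) • (contraction G ^ (2 * k - 1)) (R ^ k))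
        (doubleForm11 b) := by
  have hu : IsUnit G.det := hd.ne'.isUnit
  have hRk : R ^ k ∈ bidegree n (2 * k) := pow_mem_bidegree hR k
  have hbR : doubleForm11 b * R ^ k ∈ bidegree n (2 * k + 1) := by
    rw [add_comm]; exact mul_mem_bidegree (doubleForm11_mem b) hRk
  have h1 := scalarPart_doubleStar_metric_pow_mul hG hd hbR hk
  rw [contraction_pow_doubleForm11_mul hG b hRk, ← Nat.sub_sub] at h1
  rw [mul_assoc, commute_doubleForm11 b hRk, h1]
  -- For `k = 0` the interior product term has coefficient zero, leaving the trace `⟨g, b⟩`. For `k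
  -- ≥ 1` the factor `2k + 1` turns `1/(2k+1)!` into `1/(2k)!`, and the further factor `2k` of the
  -- second term gives `1/(2k-1)!`.
  rcases Nat.eq_zero_or_pos k with rfl | hk0
  · simp [doubleInner_metric₁₁ hG hu]
  · have h2 : (contraction G ^ (2 * k - 1)) (R ^ k) ∈ bidegree n 1 :=
      contraction_pow_mem G (by rwa [Nat.add_sub_cancel' (by omega)])
    rw [if_neg hk0.ne', scalarPart_doubleStar_metric_pow_mul hG hd hRk hk.le,
      map_sub (doubleInner G), map_smul (doubleInner G), map_smul (doubleInner G),
      LinearMap.sub_apply, LinearMap.smul_apply, LinearMap.smul_apply,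
      doubleInner_metric₁₁ hG hu, doubleInner_doubleForm11 hG hb h2]
    obtain ⟨q, hq⟩ : ∃ q, 2 * k = q + 1 := ⟨2 * k - 1, by omega⟩
    have hq' : (q.factorial : ℝ) ≠ 0 := by exact_mod_cast q.factorial_ne_zero
    rw [hq, Nat.add_sub_cancel, Nat.factorial_succ, Nat.factorial_succ]
    simp only [map_sub, map_smul, smul_eq_mul]
    push_cast
    field_simp

end Lovelock

/-! ### The Gauss formula -/

section LocalGeometry

variable {n m : ℕ}

lemma partialDeriv_partialDeriv {W : Type*} [NormedAddCommGroup W] [NormedSpace ℝ W]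
    {F : Vec n → W} {y : Vec n} (hF : ContDiffAt ℝ 2 F y) (i j : Fin n) :
    partialDeriv i (partialDeriv j F) y = fderiv ℝ (fderiv ℝ F) y (basisVec i) (basisVec j) := by
  have h : DifferentiableAt ℝ (fderiv ℝ F) y :=
    (hF.fderiv_right (m := 1) le_rfl).differentiableAt one_ne_zero
  change fderiv ℝ (fun z => fderiv ℝ F z (basisVec j)) y (basisVec i) = _
  rw [fderiv_clm_apply h (differentiableAt_const _)]
  simp

lemma partialDeriv_comm {W : Type*} [NormedAddCommGroup W] [NormedSpace ℝ W]
    {F : Vec n → W} {y : Vec n} (hF : ContDiffAt ℝ 2 F y) (i j : Fin n) :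
    partialDeriv i (partialDeriv j F) y = partialDeriv j (partialDeriv i F) y := by
  rw [partialDeriv_partialDeriv hF, partialDeriv_partialDeriv hF]
  exact hF.isSymmSndFDerivAt (by simp) _ _

lemma differentiableAt_partialDeriv {W : Type*} [NormedAddCommGroup W] [NormedSpace ℝ W]
    {F : Vec n → W} {y : Vec n} (hF : ContDiffAt ℝ 2 F y) (i : Fin n) :
    DifferentiableAt ℝ (partialDeriv i F) y :=
  ((hF.fderiv_right (m := 1) le_rfl).differentiableAt one_ne_zero).clm_apply
    (differentiableAt_const _)

lemma partialDeriv_coord {F : Vec n → Vec m} {y : Vec n} (hF : DifferentiableAt ℝ F y)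
    (i : Fin n) (a : Fin m) :
    partialDeriv i (fun z => F z a) y = partialDeriv i F y a := by
  have h := ((EuclideanSpace.proj a : Vec m →L[ℝ] ℝ).hasFDerivAt.comp y hF.hasFDerivAt).fderiv
  exact congrArg (fun L => L (basisVec i)) h

lemma partialDeriv_partialDeriv_coord {F : Vec n → Vec m} {y : Vec n} (hF : ContDiffAt ℝ 2 F y)
    (i j : Fin n) (a : Fin m) :
    partialDeriv i (partialDeriv j fun z => F z a) y = partialDeriv i (partialDeriv j F) y a := by
  have h : partialDeriv j (fun z => F z a) =ᶠ[nhds y] fun z => partialDeriv j F z a := by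
    filter_upwards [hF.eventually (by simp)] with z hz
    exact partialDeriv_coord (hz.differentiableAt two_ne_zero) j a
  rw [← partialDeriv_coord (differentiableAt_partialDeriv hF j)]
  exact congrArg (fun L : Vec n →L[ℝ] ℝ => L (basisVec i)) h.fderiv_eq

/-- The Gram matrix of the coordinate vector fields of a parametrized submanifold. -/
def pullbackGram (F : Vec n → Vec m) (y : Vec n) : Matrix (Fin n) (Fin n) ℝ :=
  Matrix.gram ℝ fun i => partialDeriv i F y

lemma pullbackGram_isSymm (F : Vec n → Vec m) (y : Vec n) : (pullbackGram F y).IsSymm := by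
  ext i j
  exact real_inner_comm (partialDeriv i F y) (partialDeriv j F y)

lemma partialDeriv_pullbackGram {F : Vec n → Vec m} {y : Vec n} (hF : ContDiffAt ℝ 2 F y)
    {G : Vec n → Matrix (Fin n) (Fin n) ℝ} (hG : G =ᶠ[nhds y] pullbackGram F) (s i j : Fin n) :
    partialDeriv s (fun z => G z i j) y
      = ⟪partialDeriv i F y, partialDeriv s (partialDeriv j F) y⟫
        + ⟪partialDeriv s (partialDeriv i F) y, partialDeriv j F y⟫ := by
  have h : (fun z => G z i j) =ᶠ[nhds y] fun z => ⟪partialDeriv i F z, partialDeriv j F z⟫ := by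
    filter_upwards [hG] with z hz
    rw [hz]; rfl
  rw [partialDeriv, h.fderiv_eq]
  exact fderiv_inner_apply ℝ (differentiableAt_partialDeriv hF i)
    (differentiableAt_partialDeriv hF j) _

/-- The product rule gives six terms; by symmetry of second derivatives four cancel and two agree,
which absorbs the `1/2`. Equality of `G` with the pullback near `y` is needed because `christoffel`
differentiates `G`. -/
lemma christoffel_pullbackGram {F : Vec n → Vec m} {y : Vec n} (hF : ContDiffAt ℝ 2 F y)
    {G : Vec n → Matrix (Fin n) (Fin n) ℝ} (hG : G =ᶠ[nhds y] pullbackGram F) (l i j : Fin n) :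
    christoffel G l i j y = ∑ s, (pullbackGram F y)⁻¹ l s *
      ⟪partialDeriv i (partialDeriv j F) y, partialDeriv s F y⟫ := by
  rw [christoffel, Finset.mul_sum]
  refine Finset.sum_congr rfl fun s _ => ?_
  rw [partialDeriv_pullbackGram hF hG, partialDeriv_pullbackGram hF hG,
    partialDeriv_pullbackGram hF hG, hG.eq_of_nhds, partialDeriv_comm hF j i,
    partialDeriv_comm hF s i, partialDeriv_comm hF s j,
    real_inner_comm (partialDeriv j F y)]
  ring

lemma coe_basisFun_toBasis :
    ⇑(EuclideanSpace.basisFun (Fin n) ℝ).toBasis = (basisVec : Fin n → Vec n) := by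
  funext i
  simp [basisVec]

/-- The Gauss formula: the second covariant derivative of a parametrized submanifold is the normal
part of its second derivative. -/
lemma starProjection_secondDeriv {F : Vec n → Vec m} {y : Vec n} (hF : ContDiffAt ℝ 2 F y)
    {G : Vec n → Matrix (Fin n) (Fin n) ℝ} (hG : G =ᶠ[nhds y] pullbackGram F)
    (hd : IsUnit (pullbackGram F y).det) {K : Submodule ℝ (Vec m)}
    (hK : K = Submodule.span ℝ (Set.range fun i => partialDeriv i F y)) (i j : Fin n) :
    Kᗮ.starProjection (partialDeriv i (partialDeriv j F) y)
      = partialDeriv i (partialDeriv j F) y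
        - ∑ l, christoffel G l i j y • partialDeriv l F y := by
  have hmem (l : Fin n) : partialDeriv l F y ∈ K := by
    rw [hK]; exact Submodule.subset_span ⟨l, rfl⟩
  -- The Christoffel symbols are the coefficients of the tangential projection: the difference must
  -- be orthogonal to each `∂_t F`, and the subtracted sum must be tangent.
  refine Submodule.eq_starProjection_of_mem_orthogonal ?_ ?_
  · have hc : ∀ w : Vec m, (∀ t, ⟪partialDeriv t F y, w⟫ = 0) → w ∈ Kᗮ := by
      intro w hw
      rw [hK, Submodule.mem_orthogonal]
      intro u hu
      induction hu using Submodule.span_induction with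
      | mem u hu => obtain ⟨t, rfl⟩ := hu; exact hw t
      | zero => simp
      | add u v _ _ hu hv => rw [inner_add_left, hu, hv, add_zero]
      | smul r u _ hu => rw [inner_smul_left, hu, mul_zero]
    refine hc _ fun t => ?_
    simp only [inner_sub_right, inner_sum, inner_smul_right, christoffel_pullbackGram hF hG]
    have h1 (s : Fin n) : ∑ l, (pullbackGram F y)⁻¹ l s * ⟪partialDeriv t F y, partialDeriv l F y⟫
        = (1 : Matrix (Fin n) (Fin n) ℝ) t s := by
      rw [← Matrix.mul_nonsing_inv _ hd, Matrix.mul_apply]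
      exact Finset.sum_congr rfl fun l _ => mul_comm _ _
    simp only [Finset.sum_mul]
    rw [Finset.sum_comm]
    have h2 (s : Fin n) : ∑ l, (pullbackGram F y)⁻¹ l s *
          ⟪partialDeriv i (partialDeriv j F) y, partialDeriv s F y⟫ *
            ⟪partialDeriv t F y, partialDeriv l F y⟫
        = (1 : Matrix (Fin n) (Fin n) ℝ) t s *
          ⟪partialDeriv i (partialDeriv j F) y, partialDeriv s F y⟫ := by
      rw [← h1, Finset.sum_mul]
      exact Finset.sum_congr rfl fun l _ => by ring
    simp [h2, Matrix.one_apply, real_inner_comm]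
  · rw [sub_sub_cancel, Submodule.mem_orthogonal']
    intro u hu
    exact Submodule.inner_right_of_mem_orthogonal
      (Submodule.sum_mem _ fun l _ => Submodule.smul_mem _ _ (hmem l)) hu

end LocalGeometry

/-! ### From charts to the immersed manifold -/

section Immersion

variable {n m : ℕ} {M : Type*} [TopologicalSpace M] [ChartedSpace (Vec n) M]
  [IsManifold (𝓡 n) ∞ M] {f : M → Vec m}

/-- An immersion read in the preferred chart at `x`. -/
def inChart (n : ℕ) [ChartedSpace (Vec n) M] (f : M → Vec m) (x : M) : Vec n → Vec m :=
  f ∘ (extChartAt (𝓡 n) x).symm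

lemma mdifferentiableAt_extChartAt_symm (x : M) {y : Vec n}
    (hy : y ∈ (extChartAt (𝓡 n) x).target) :
    MDifferentiableAt 𝓘(ℝ, Vec n) (𝓡 n) (extChartAt (𝓡 n) x).symm y := by
  have h := mdifferentiableWithinAt_extChartAt_symm (I := 𝓡 n) hy
  rwa [ModelWithCorners.Boundaryless.range_eq_univ, mdifferentiableWithinAt_univ] at h

lemma differential_mfderiv_symm (hf : IsSmoothImmersion (n := n) f) (x : M) {y : Vec n}
    (hy : y ∈ (extChartAt (𝓡 n) x).target) (v : Vec n) :
    differential f ((extChartAt (𝓡 n) x).symm y)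
        (mfderiv 𝓘(ℝ, Vec n) (𝓡 n) (extChartAt (𝓡 n) x).symm y v)
      = fderiv ℝ (inChart n f x) y v := by
  have h := mfderiv_comp y
    (hf.1.mdifferentiableAt (by simp) : MDifferentiableAt (𝓡 n) 𝓘(ℝ, Vec m) f _)
    (mdifferentiableAt_extChartAt_symm x hy)
  rw [mfderiv_eq_fderiv] at h
  exact (congrArg (fun L => L v) h).symm

lemma contDiffAt_inChart (hf : IsSmoothImmersion (n := n) f) (x : M) :
    ContDiffAt ℝ 2 (inChart n f x) (extChartAt (𝓡 n) x x) := by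
  have h : ContMDiffOn 𝓘(ℝ, Vec n) 𝓘(ℝ, Vec m) ∞ (inChart n f x) (extChartAt (𝓡 n) x).target :=
    hf.1.comp_contMDiffOn (contMDiffOn_extChartAt_symm x)
  rw [contMDiffOn_iff_contDiffOn] at h
  exact (h.contDiffAt (extChartAt_target_mem_nhds x)).of_le (WithTop.coe_le_coe.2 le_top)

lemma gram_inducedMetric (hf : IsSmoothImmersion (n := n) f) (x : M) {y : Vec n}
    (hy : y ∈ (extChartAt (𝓡 n) x).target) :
    gram (inducedMetric (n := n) f) x y = pullbackGram (inChart n f x) y := by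
  ext i j
  change ⟪differential f _ _, differential f _ _⟫ = _
  rw [differential_mfderiv_symm hf x hy, differential_mfderiv_symm hf x hy]
  rfl

lemma gram_inducedMetric_eventuallyEq (hf : IsSmoothImmersion (n := n) f) (x : M) :
    gram (inducedMetric (n := n) f) x =ᶠ[nhds (extChartAt (𝓡 n) x x)]
      pullbackGram (inChart n f x) := by
  filter_upwards [extChartAt_target_mem_nhds (I := 𝓡 n) x] with y hy
  exact gram_inducedMetric hf x hy

lemma isInvertible_mfderiv_symm (x : M) {y : Vec n} (hy : y ∈ (extChartAt (𝓡 n) x).target) :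
    (mfderiv 𝓘(ℝ, Vec n) (𝓡 n) (extChartAt (𝓡 n) x).symm y).IsInvertible := by
  have h := isInvertible_mfderivWithin_extChartAt_symm (I := 𝓡 n) hy
  rwa [ModelWithCorners.Boundaryless.range_eq_univ, mfderivWithin_univ] at h

/-- The coordinate tangent vectors are independent, since `df` is injective and the derivative of
the inverse chart is invertible; their Gram matrix is therefore positive definite. -/
lemma det_pullbackGram_pos (hf : IsSmoothImmersion (n := n) f) (x : M) :
    0 < (pullbackGram (inChart n f x) (extChartAt (𝓡 n) x x)).det := by
  have hy := mem_extChartAt_target (I := 𝓡 n) x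
  refine (Matrix.posDef_gram_iff_linearIndependent.2 ?_).det_pos
  have hinj : Function.Injective (fderiv ℝ (inChart n f x) (extChartAt (𝓡 n) x x)) := by
    intro u v huv
    rw [← differential_mfderiv_symm hf x hy, ← differential_mfderiv_symm hf x hy] at huv
    exact (isInvertible_mfderiv_symm x hy).injective (hf.2 _ huv)
  have hb : LinearIndependent ℝ (basisVec : Fin n → Vec n) :=
    coe_basisFun_toBasis ▸ (EuclideanSpace.basisFun (Fin n) ℝ).toBasis.linearIndependent
  exact hb.map' (fderiv ℝ (inChart n f x) (extChartAt (𝓡 n) x x)).toLinearMap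
    (LinearMap.ker_eq_bot.2 hinj)

lemma range_differential (hf : IsSmoothImmersion (n := n) f) (x : M) :
    LinearMap.range (differential (n := n) f x).toLinearMap
      = Submodule.span ℝ
        (Set.range fun i => partialDeriv i (inChart n f x) (extChartAt (𝓡 n) x x)) := by
  have hy := mem_extChartAt_target (I := 𝓡 n) x
  set y := extChartAt (𝓡 n) x x with hydef
  have hx : (extChartAt (𝓡 n) x).symm y = x := extChartAt_to_inv x
  have h1 : LinearMap.range (differential (n := n) f ((extChartAt (𝓡 n) x).symm y)).toLinearMap
      = LinearMap.range (fderiv ℝ (inChart n f x) y).toLinearMap := by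
    refine le_antisymm ?_ ?_
    · rintro _ ⟨v, rfl⟩
      obtain ⟨w, rfl⟩ := (isInvertible_mfderiv_symm x hy).surjective v
      exact ⟨w, (differential_mfderiv_symm hf x hy w).symm⟩
    · rintro _ ⟨w, rfl⟩
      exact ⟨_, differential_mfderiv_symm hf x hy w⟩
  have h2 : Submodule.span ℝ (Set.range (basisVec : Fin n → Vec n)) = ⊤ :=
    coe_basisFun_toBasis ▸ (EuclideanSpace.basisFun (Fin n) ℝ).toBasis.span_eq
  -- The base points agree only propositionally and the tangent space depends on them; the ranges
  -- all lie in the fixed space `Vec m`, so equality is transported there.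
  have h3 : LinearMap.range (differential (n := n) f ((extChartAt (𝓡 n) x).symm y)).toLinearMap
      = LinearMap.range (differential (n := n) f x).toLinearMap :=
    congrArg (fun z => LinearMap.range (differential (n := n) f z).toLinearMap) hx
  rw [← h3, h1, LinearMap.range_eq_map, ← h2, Submodule.map_span, ← Set.range_comp]
  rfl

/-- The Hessian of a coordinate function is the corresponding component of the second fundamental
form. -/
lemma hessianForm_coord (hf : IsSmoothImmersion (n := n) f) (x : M) (a : Fin m) :
    hessianForm (inducedMetric (n := n) f) (fun z => f z a) x
      = doubleForm11 fun i j => secondFundamentalForm n f x i j a := by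
  have hF := contDiffAt_inChart hf x
  have hG := gram_inducedMetric_eventuallyEq hf x
  unfold hessianForm
  congr 1
  funext i j
  have h := starProjection_secondDeriv hF hG (det_pullbackGram_pos hf x).ne'.isUnit
    (range_differential hf x) i j
  have h' := congrArg (fun w : Vec m => w a) h
  refine Eq.trans ?_ h'.symm
  change partialDeriv i (partialDeriv j fun z => inChart n f x z a) _
    - ∑ l, christoffel _ l i j _ * partialDeriv l (fun z => inChart n f x z a) _ = _
  simp only [partialDeriv_partialDeriv_coord hF,
    partialDeriv_coord (hF.differentiableAt two_ne_zero)]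
  simp

lemma secondFundamentalForm_comm (hf : IsSmoothImmersion (n := n) f) (x : M) (i j : Fin n) :
    secondFundamentalForm n f x i j = secondFundamentalForm n f x j i :=
  congrArg _ (partialDeriv_comm (contDiffAt_inChart hf x) i j)

lemma oddGaussBonnetCurvature_eq (hf : IsSmoothImmersion (n := n) f) {k : ℕ} (hk : 2 * k < n)
    (x : M) (N : Vec m) :
    oddGaussBonnetCurvature n f k x N
      = doubleInner (gramAt (inducedMetric (n := n) f) x)
        (einsteinLovelock (inducedMetric (n := n) f) k x)
        (secondFundamentalFormAlong n f x N) := by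
  have hG : gramAt (inducedMetric (n := n) f) x
      = pullbackGram (inChart n f x) (extChartAt (𝓡 n) x x) :=
    gram_inducedMetric hf x (mem_extChartAt_target x)
  exact scalarPart_doubleStar_eq_doubleInner (hG ▸ pullbackGram_isSymm _ _)
    (hG ▸ det_pullbackGram_pos hf x) hk (doubleForm22_mem _)
    fun i j => by rw [secondFundamentalForm_comm hf]

/-- `B` takes normal values and the projection is self-adjoint, so pairing `B` with `e_a` is the
same as pairing it with the normal part of `e_a`. -/
lemma ell_coord (hf : IsSmoothImmersion (n := n) f) {k : ℕ} (hk : 2 * k < n) (x : M)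
    (a : Fin m) :
    ell (inducedMetric (n := n) f) k (fun z => f z a) x
      = - oddGaussBonnetCurvature n f k x
        ((normalSpace n f x).starProjection (EuclideanSpace.single a 1)) := by
  rw [ell, oddGaussBonnetCurvature_eq hf hk, hessianForm_coord hf]
  congr 3
  funext i j
  rw [secondFundamentalForm, ← Submodule.inner_starProjection_left_eq_right,
    Submodule.starProjection_eq_self_iff.2 (Submodule.starProjection_apply_mem _ _)]
  simp [PiLp.inner_apply]

/-- `B_N = ∑ N_a Hess(x_a)` by linearity in `N`, for any `N` in the ambient space; the sign is the
one in the definition of `ell`. -/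
lemma oddGaussBonnetCurvature_eq_sum (hf : IsSmoothImmersion (n := n) f) {k : ℕ}
    (hk : 2 * k < n) (x : M) (N : Vec m) :
    oddGaussBonnetCurvature n f k x N
      = - ∑ a, N a * ell (inducedMetric (n := n) f) k (fun z => f z a) x := by
  have h : secondFundamentalFormAlong n f x N
      = ∑ a, N a • hessianForm (inducedMetric (n := n) f) (fun z => f z a) x := by
    simp only [hessianForm_coord hf, secondFundamentalFormAlong, doubleForm11, Finset.smul_sum,
      smul_smul]
    symm
    rw [Finset.sum_comm]
    refine Finset.sum_congr rfl fun i _ => ?_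
    rw [Finset.sum_comm]
    refine Finset.sum_congr rfl fun j _ => ?_
    rw [← Finset.sum_smul]
    simp [PiLp.inner_apply]
  rw [oddGaussBonnetCurvature_eq hf hk, h]
  simp [ell]

end Immersion

end GaussBonnet

end

theorem mainTheorem5 (n m k : ℕ) (hk : 2 * k < n)
    (M : Type*) [TopologicalSpace M] [ChartedSpace (EuclideanSpace ℝ (Fin n)) M]
    [IsManifold (𝓡 n) ∞ M]
    (f : M → EuclideanSpace ℝ (Fin m)) (hf : GaussBonnet.IsSmoothImmersion (n := n) f) :
    GaussBonnet.IsTwoKMinimal n f k ↔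
      ∀ i : Fin m, GaussBonnet.IsEllHarmonic (GaussBonnet.inducedMetric (n := n) f) k
        (fun x => f x i) := by
  constructor
  · intro h a x
    rw [GaussBonnet.ell_coord hf hk, h x _ (Submodule.starProjection_apply_mem _ _), neg_zero]
  · intro h x N _
    rw [GaussBonnet.oddGaussBonnetCurvature_eq_sum hf hk]
    simp [h _ x]
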